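/- For a unit vector $\varphi\in H_A\otimes H_B$ (finite-dimensional complex Hilbert spaces) let $C(\varphi)=\sqrt{2\,(1-\operatorname{tr}\rho_A^2)}$, where $\rho_A=\operatorname{tr}_B|\varphi\rangle\langle\varphi|$. For a bipartite state (density matrix) $\rho$ on $H_A\otimes H_B$ let the concurrence be the convex roof $C(\rho_{A|B})=\min\sum_i q_iC(\varphi_i)$, the minimum being taken over all finite pure state ensembles $\{q_i,\varphi_i\}$ of $\rho$, i.e. $q_i\ge0$, $\sum_iq_i=1$, $\varphi_i$ unit vectors and $\rho=\sum_iq_i|\varphi_i\rangle\langle\varphi_i|$. Theorem 1. Let $n\ge2$ be an integer and let $\rho$ be a state on $H_{A_1}\otimes H_{A_2}\otimes H_{A_3}$ with $\dim H_{A_1}=\dim H_{A_2}=2$ and $\dim H_{A_3}=2^{n-2}$. Let $\rho_{A_1A_2}=\operatorname{tr}_{A_3}\rho$ and $\rho_{A_1A_3}=\operatorname{tr}_{A_2}\rho$, and let $C(\rho_{A_1|A_2A_3})$ be the concurrence of $\rho$ regarded as a bipartite state on $H_{A_1}\otimes(H_{A_2}\otimes H_{A_3})$. Let $k,p,r,\alpha$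 be real numbers with $k\ge1$, $\frac12\le p\le1$, $r\ge2$ and $0\le\alpha\le\frac r2$ (with the convention $0^0=1$). (1) If $C^r(\rho_{A_1A_3})\ge k\,C^r(\rho_{A_1A_2})$, then $$C^\alpha(\rho_{A_1|A_2A_3})\ge p^{\alpha/r}C^\alpha(\rho_{A_1A_2})+\frac{(1+k)^{\alpha/r}-p^{\alpha/r}}{k^{\alpha/r}}\,C^\alpha(\rho_{A_1A_3}).$$ (2) If $C^r(\rho_{A_1A_2})\ge k\,C^r(\rho_{A_1A_3})$, then $$C^\alpha(\rho_{A_1|A_2A_3})\ge p^{\alpha/r}C^\alpha(\rho_{A_1A_3})+\frac{(1+k)^{\alpha/r}-p^{\alpha/r}}{k^{\alpha/r}}\,C^\alpha(\rho_{A_1A_2}).$$ -/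

import Mathlib

open Matrix
open scoped ComplexOrder

/-- A quantum state: a positive semidefinite complex matrix of trace one. -/
def IsDensityMatrix {ι : Type*} [Fintype ι] (ρ : Matrix ι ι ℂ) : Prop :=
  ρ.PosSemidef ∧ ρ.trace = 1

/-- A pure state vector, that is, a unit vector in coordinates. -/
def IsUnitVector {ι : Type*} [Fintype ι] (φ : ι → ℂ) : Prop :=
  ∑ i, ‖φ i‖ ^ 2 = 1

/-- The rank-one operator `|φ⟩⟨φ|`. -/
def ketBra {ι : Type*} (φ : ι → ℂ) : Matrix ι ι ℂ :=
  vecMulVec φ (star φ)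

/-- The reduced matrix on the first factor of a bipartite system: the second is traced out. -/
def reduceFst {A B : Type*} [Fintype B] (ρ : Matrix (A × B) (A × B) ℂ) : Matrix A A ℂ :=
  of fun i i' => ∑ j, ρ (i, j) (i', j)

/-- `ρ_{A₁A₂}`: the third factor of a tripartite system is traced out. -/
def reduceOneTwo {A B C : Type*} [Fintype C] (ρ : Matrix (A × B × C) (A × B × C) ℂ) :
    Matrix (A × B) (A × B) ℂ :=
  of fun x y => ∑ l, ρ (x.1, x.2, l) (y.1, y.2, l)

/-- `ρ_{A₁A₃}`: the second factor of a tripartite system is traced out. -/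
def reduceOneThree {A B C : Type*} [Fintype B] (ρ : Matrix (A × B × C) (A × B × C) ℂ) :
    Matrix (A × C) (A × C) ℂ :=
  of fun x y => ∑ j, ρ (x.1, j, x.2) (y.1, j, y.2)

/-- The concurrence `√(2 (1 - tr ρ_A²))` of a bipartite pure state, with `ρ_A` the reduced matrix
of `|φ⟩⟨φ|` (the trace is a real number, since `ρ_A` is Hermitian). -/
noncomputable def pureConcurrence {A B : Type*} [Fintype A] [Fintype B] (φ : A × B → ℂ) : ℝ :=
  Real.sqrt (2 * (1 - (reduceFst (ketBra φ) * reduceFst (ketBra φ)).trace.re))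

/-- `{q i, φ i}` is a (finite) pure state ensemble of `ρ`. -/
structure IsEnsemble {ι : Type*} [Fintype ι] (ρ : Matrix ι ι ℂ) {m : ℕ}
    (q : Fin m → ℝ) (φ : Fin m → ι → ℂ) : Prop where
  nonneg : ∀ i, 0 ≤ q i
  sum_eq_one : ∑ i, q i = 1
  unit : ∀ i, IsUnitVector (φ i)
  decomp : ∑ i, (q i : ℂ) • ketBra (φ i) = ρ

/-- The average concurrences of all the pure state ensembles of a bipartite state. -/
def ensembleConcurrences {A B : Type*} [Fintype A] [Fintype B]
    (ρ : Matrix (A × B) (A × B) ℂ) : Set ℝ :=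
  {c | ∃ (m : ℕ) (q : Fin m → ℝ) (φ : Fin m → A × B → ℂ),
    IsEnsemble ρ q φ ∧ c = ∑ i, q i * pureConcurrence (φ i)}

/-- The concurrence of a bipartite state across the cut `A | B`, as a convex roof. -/
noncomputable def concurrence {A B : Type*} [Fintype A] [Fintype B]
    (ρ : Matrix (A × B) (A × B) ℂ) : ℝ :=
  sInf (ensembleConcurrences ρ)

/-!
The three concurrences satisfy the monogamy inequality
`C(ρ_{A₁A₂})² + C(ρ_{A₁A₃})² ≤ C(ρ_{A₁|A₂A₃})²` (`concurrence_sq_add_sq_le`), for a third system of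
any dimension. The powers and the weights are then a matter of real numbers
(`rpow_weighted_le_of_sq_add_sq_le`): superadditivity of `t ↦ t ^ (r / 2)` gives
`a ^ r + b ^ r ≤ c ^ r`, and `u ↦ (1 + u) ^ x - p ^ x * u ^ x` decreases on `[0, 1]` for `x ≤ 1 / 2`.

Monogamy for mixed states follows from that for pure states by the triangle inequality in the plane,
provided that the pure case comes with explicit decompositions of the two reduced states
(`exists_decompositions_of_pure`). On `A₁A₃` these are obtained by measuring the second qubit in an
orthonormal basis. If `A₀` and `A₁` denote the resulting unnormalised states of the first qubit, the
squared average concurrence is at most `8 (det A₀ + det A₁)`, and the total squared concurrence is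
`4 det (A₀ + A₁)`; the difference is `-4 det (A₀ - A₁)`. So the claim becomes one about two-qubit
states `ρ` only (`exists_ensemble_two_qubits`): for some basis, with
`X = tr₂ ((1 ⊗ Y) ρ)` and `Y` the observable of the basis with eigenvalues `±1`, the average concurrence
of some ensemble of `ρ` is at most `2 √(-det X)`.

To prove it, write `ρ = ∑ |ψⱼ⟩⟨ψⱼ|` and use the Takagi factorization to make the four `2 × 2`
coefficient matrices `ψⱼ` orthogonal for the polarised determinant, with `det ψⱼ = sⱼ ≥ 0`. A Hadamard
transformation after multiplication by phases yields, for every choice of signs, an ensemble with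
average concurrence `2 |∑ ± sⱼ|`. If all `sⱼ` are positive, orthogonality forces the
`ψⱼ` to be a common left factor times scalar multiples of one conjugate of the four unit quaternions
(`exists_standard_form`). For a basis adapted to the conjugating matrix, `-det X` is then a convex
combination of three squares `(∑ ± sⱼ)²` (`exists_basis_sq_signed_sum_le`). The general case follows
by compactness of the unitary groups (`exists_isDiag_trace_le`).
-/

/-! ### An inequality between weighted powers -/

lemma one_add_rpow_sub_antitoneOn {p x : ℝ} (hp : 1 / 2 ≤ p) (hx : 0 ≤ x) (hx' : x ≤ 1 / 2) :
    AntitoneOn (fun u : ℝ => (1 + u) ^ x - p ^ x * u ^ x) (Set.Icc 0 1) := by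
  refine antitoneOn_of_deriv_nonpos (convex_Icc 0 1) ?_ ?_ ?_
  · refine ContinuousOn.sub ?_ ?_
    · exact ContinuousOn.rpow_const (by fun_prop) fun u hu => Or.inr hx
    · exact ContinuousOn.mul continuousOn_const
        (ContinuousOn.rpow_const (by fun_prop) fun u hu => Or.inr hx)
  · rw [interior_Icc]
    intro u hu
    have h1 : (1 + u) ≠ 0 := by linarith [hu.1]
    have h2 : u ≠ 0 := hu.1.ne'
    exact (DifferentiableAt.sub (DifferentiableAt.rpow_const (by fun_prop) (Or.inl h1))
      ((DifferentiableAt.rpow_const (by fun_prop) (Or.inl h2)).const_mul _)).differentiableWithinAt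
  · rw [interior_Icc]
    intro u hu
    have hu0 : 0 < u := hu.1
    have h1 : 0 < 1 + u := by linarith
    have hd : HasDerivAt (fun u : ℝ => (1 + u) ^ x - p ^ x * u ^ x)
        (1 * x * (1 + u) ^ (x - 1) - p ^ x * (1 * x * u ^ (x - 1))) u :=
      (((hasDerivAt_id u).const_add 1).rpow_const (Or.inl h1.ne')).sub
        (((hasDerivAt_id u).rpow_const (Or.inl hu0.ne')).const_mul _)
    rw [hd.deriv]
    have key : (1 + u) ^ (x - 1) ≤ p ^ x * u ^ (x - 1) := by
      have e : (1 + u) ^ (x - 1) = (u / (1 + u)) ^ (1 - x) * u ^ (x - 1) := by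
        rw [Real.div_rpow hu0.le h1.le, ← neg_sub x 1, Real.rpow_neg hu0.le, Real.rpow_neg h1.le]
        have := (Real.rpow_pos_of_pos hu0 (x - 1)).ne'
        have := (Real.rpow_pos_of_pos h1 (x - 1)).ne'
        field_simp
      rw [e]
      refine mul_le_mul_of_nonneg_right ?_ (Real.rpow_nonneg hu0.le _)
      calc (u / (1 + u)) ^ (1 - x) ≤ (1 / 2 : ℝ) ^ (1 - x) := by
            refine Real.rpow_le_rpow (by positivity) ?_ (by linarith)
            rw [div_le_div_iff₀ h1 (by norm_num)]
            linarith [hu.2]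
        _ ≤ (1 / 2 : ℝ) ^ x :=
            Real.rpow_le_rpow_of_exponent_ge (by norm_num) (by norm_num) (by linarith)
        _ ≤ p ^ x := Real.rpow_le_rpow (by norm_num) hp hx
    nlinarith

/-- The passage from monogamy of squares to monogamy of powers. In terms of `u = A / B ≤ 1 / k`
this is the antitonicity of `(1 + u) ^ x - p ^ x * u ^ x`. -/
lemma rpow_add_weighted_le {A B k p x : ℝ} (hA : 0 ≤ A) (hk : 1 ≤ k) (hp : 1 / 2 ≤ p)
    (hx : 0 ≤ x) (hx' : x ≤ 1 / 2) (hAB : k * A ≤ B) :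
    p ^ x * A ^ x + ((1 + k) ^ x - p ^ x) / k ^ x * B ^ x ≤ (A + B) ^ x := by
  have hk0 : 0 < k := by linarith
  have hB : 0 ≤ B := le_trans (by positivity) hAB
  rcases hB.eq_or_lt with rfl | hB
  · have hA0 : A = 0 := by nlinarith
    subst hA0
    rcases hx.eq_or_lt with rfl | hx
    · simp
    · simp [Real.zero_rpow hx.ne']
  · have hu : A / B ≤ 1 / k := by
      rw [div_le_div_iff₀ hB hk0]; linarith
    have hk1 : 1 / k ≤ 1 := by rw [div_le_one hk0]; exact hk
    have h := one_add_rpow_sub_antitoneOn hp hx hx' (a := A / B) (b := 1 / k)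
      ⟨by positivity, hu.trans hk1⟩ ⟨by positivity, hk1⟩ hu
    simp only at h
    have e1 : ((1 + k) ^ x - p ^ x) / k ^ x = (1 + 1 / k) ^ x - p ^ x * (1 / k) ^ x := by
      rw [show 1 + 1 / k = (1 + k) / k by field_simp; ring, Real.div_rpow (by positivity) hk0.le,
        Real.div_rpow zero_le_one hk0.le, Real.one_rpow]
      ring
    have e2 : (A + B) ^ x = (1 + A / B) ^ x * B ^ x := by
      rw [← Real.mul_rpow (by positivity) hB.le]
      congr 1
      field_simp
      ring
    have e3 : A ^ x = (A / B) ^ x * B ^ x := by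
      rw [← Real.mul_rpow (by positivity) hB.le]
      congr 1
      field_simp
    have := mul_le_mul_of_nonneg_right h (Real.rpow_nonneg hB.le x)
    rw [e1, e2, e3]
    linarith

lemma rpow_weighted_le_of_sq_add_sq_le {a b c k p r α : ℝ} (ha : 0 ≤ a) (hb : 0 ≤ b) (hc : 0 ≤ c)
    (hmono : a ^ 2 + b ^ 2 ≤ c ^ 2) (hk : 1 ≤ k) (hp : 1 / 2 ≤ p) (hr : 2 ≤ r)
    (hα : 0 ≤ α) (hα' : α ≤ r / 2) (hab : k * a ^ r ≤ b ^ r) :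
    p ^ (α / r) * a ^ α + ((1 + k) ^ (α / r) - p ^ (α / r)) / k ^ (α / r) * b ^ α ≤ c ^ α := by
  have hr0 : 0 < r := by linarith
  have hx : 0 ≤ α / r := by positivity
  have hx' : α / r ≤ 1 / 2 := by rw [div_le_div_iff₀ hr0 (by norm_num)]; linarith
  have pw : ∀ y : ℝ, 0 ≤ y → y ^ α = (y ^ r) ^ (α / r) := fun y hy => by
    rw [← Real.rpow_mul hy]; congr 1; field_simp
  have hsum : a ^ r + b ^ r ≤ c ^ r := by
    have sq : ∀ y : ℝ, 0 ≤ y → y ^ r = (y ^ 2) ^ (r / 2) := fun y hy => by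
      rw [← Real.rpow_natCast, ← Real.rpow_mul hy]; congr 1; push_cast; ring
    rw [sq a ha, sq b hb, sq c hc]
    refine le_trans ?_ (Real.rpow_le_rpow (by positivity) hmono (by positivity))
    have h := NNReal.add_rpow_le_rpow_add ⟨a ^ 2, sq_nonneg a⟩ ⟨b ^ 2, sq_nonneg b⟩
      (show (1 : ℝ) ≤ r / 2 by linarith)
    exact NNReal.coe_le_coe.2 h
  rw [pw a ha, pw b hb, pw c hc]
  exact (rpow_add_weighted_le (Real.rpow_nonneg ha r) hk hp hx hx' hab).trans
    (Real.rpow_le_rpow (add_nonneg (Real.rpow_nonneg ha r) (Real.rpow_nonneg hb r)) hsum hx)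

/-! ### Takagi factorization -/

lemma isCompact_unitaryGroup (n : Type*) [Fintype n] [DecidableEq n] :
    IsCompact (unitaryGroup n ℂ : Set (Matrix n n ℂ)) := by
  have hK : IsCompact (Set.univ.pi fun _ : n => Set.univ.pi fun _ : n =>
      Metric.closedBall (0 : ℂ) 1) :=
    isCompact_univ_pi fun _ => isCompact_univ_pi fun _ => isCompact_closedBall _ _
  refine IsCompact.of_isClosed_subset (s := Set.univ.pi fun _ : n => Set.univ.pi fun _ : n =>
      Metric.closedBall (0 : ℂ) 1) hK ?_ ?_
  · have : (unitaryGroup n ℂ : Set (Matrix n n ℂ)) = {U | star U * U = 1} := by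
      ext U; exact mem_unitaryGroup_iff'
    rw [this]
    exact isClosed_eq (by fun_prop) continuous_const
  · intro U hU i _ j _
    simpa using entry_norm_bound_of_unitary hU i j

/-- A maximiser of `Re tr (Vᵀ T V)` over the unitary group satisfies `Im tr (S H) = 0` for
`S = Vᵀ T V` and every real symmetric involution `H`, as one sees by moving along the unitaries
`(1 + i t H) / √(1 + t²)`. -/
lemma trace_mul_im_eq_zero_of_isMax {n : Type*} [Fintype n] [DecidableEq n] {S H : Matrix n n ℂ}
    (hmax : ∀ Z ∈ unitaryGroup n ℂ, (Zᵀ * S * Z).trace.re ≤ S.trace.re)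
    (hH : Hᴴ = H) (hH' : Hᵀ = H) (hHH : H * H = 1) : (S * H).trace.im = 0 := by
  have key : ∀ t : ℝ, 0 ≤ t ^ 2 * S.trace.re + t * (S * H).trace.im := by
    intro t
    have ht : 0 < 1 + t ^ 2 := by positivity
    set c : ℝ := (Real.sqrt (1 + t ^ 2))⁻¹ with hc
    have hcc : c ^ 2 * (1 + t ^ 2) = 1 := by
      rw [hc, inv_pow, Real.sq_sqrt ht.le, inv_mul_cancel₀ ht.ne']
    have hccC : (c : ℂ) ^ 2 * (1 + (t : ℂ) ^ 2) = 1 := by exact_mod_cast hcc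
    have hc2 : 0 < c ^ 2 := by positivity
    set Z : Matrix n n ℂ := (c : ℂ) • 1 + (c * t * Complex.I : ℂ) • H with hZ
    have hZu : Z ∈ unitaryGroup n ℂ := by
      rw [mem_unitaryGroup_iff', star_eq_conjTranspose]
      simp only [hZ, conjTranspose_add, conjTranspose_smul, conjTranspose_one, hH, add_mul, mul_add,
        smul_mul_smul_comm, one_mul, mul_one, hHH]
      have e1 : star (c : ℂ) = c := Complex.conj_ofReal c
      have e2 : star (c * t * Complex.I : ℂ) = -(c * t * Complex.I) := by
        simp
      rw [e1, e2]
      have : (c * c : ℂ) + -(c * t * Complex.I) * (c * t * Complex.I) = 1 := by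
        linear_combination hccC - c ^ 2 * t ^ 2 * Complex.I_sq
      calc _ = ((c * c : ℂ) + -(c * t * Complex.I) * (c * t * Complex.I)) • (1 : Matrix n n ℂ) := by
            module
        _ = 1 := by rw [this, one_smul]
    have hZt : Zᵀ = Z := by simp [hZ, transpose_add, transpose_smul, hH']
    have hZZ : Z * Z = (c ^ 2 * (1 - t ^ 2) : ℂ) • 1 + (2 * c ^ 2 * t * Complex.I : ℂ) • H := by
      simp only [hZ, add_mul, mul_add, smul_mul_smul_comm, one_mul, mul_one, hHH]
      have : (c * t * Complex.I * (c * t * Complex.I) : ℂ) = -(c ^ 2 * t ^ 2) := by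
        linear_combination c ^ 2 * t ^ 2 * Complex.I_sq
      rw [this]
      module
    have h := hmax Z hZu
    rw [hZt, mul_assoc, trace_mul_comm, mul_assoc, hZZ] at h
    simp only [mul_add, Matrix.mul_smul, mul_one, trace_add, trace_smul, smul_eq_mul] at h
    have e : ((c ^ 2 * (1 - t ^ 2) : ℂ) * S.trace + (2 * c ^ 2 * t * Complex.I : ℂ) *
        (S * H).trace).re = c ^ 2 * (1 - t ^ 2) * S.trace.re - 2 * c ^ 2 * t * (S * H).trace.im := by
      have r1 : (c ^ 2 * (1 - t ^ 2) : ℂ) = ((c ^ 2 * (1 - t ^ 2) : ℝ) : ℂ) := by push_cast; ring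
      have r2 : (2 * c ^ 2 * t * Complex.I : ℂ) * (S * H).trace
          = ((2 * c ^ 2 * t : ℝ) : ℂ) * (Complex.I * (S * H).trace) := by push_cast; ring
      rw [r1, r2, Complex.add_re, Complex.re_ofReal_mul, Complex.re_ofReal_mul, Complex.I_mul_re]
      ring
    rw [e] at h
    have h2 : 0 ≤ 2 * c ^ 2 * (t ^ 2 * S.trace.re + t * (S * H).trace.im) := by
      linear_combination h - S.trace.re * hcc
    exact nonneg_of_mul_nonneg_right h2 (by positivity)
  set a := S.trace.re
  set m := (S * H).trace.im
  by_contra hm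
  have ha : 0 < |a| + 1 := by positivity
  have h := key (-m / (|a| + 1))
  have : (-m / (|a| + 1)) ^ 2 * a + -m / (|a| + 1) * m
      = m ^ 2 / (|a| + 1) ^ 2 * (a - (|a| + 1)) := by
    field_simp
    ring
  rw [this] at h
  have h1 : 0 < m ^ 2 / (|a| + 1) ^ 2 := by positivity
  nlinarith [le_abs_self a]

/-- If `Re tr (Zᵀ S Z)` is maximal over the unitary group at `Z = 1`, then the symmetric matrix `S`
is real: reflections `1 - 2 u uᵀ` turn the stationarity condition into `Im (uᵀ S u) = 0`. -/
lemma im_eq_zero_of_isMax {n : Type*} [Fintype n] [DecidableEq n] {S : Matrix n n ℂ}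
    (hS : S.IsSymm)
    (hmax : ∀ Z ∈ unitaryGroup n ℂ, (Zᵀ * S * Z).trace.re ≤ S.trace.re) (i j : n) :
    (S i j).im = 0 := by
  have h1 : S.trace.im = 0 := by
    simpa using trace_mul_im_eq_zero_of_isMax hmax conjTranspose_one transpose_one (one_mul 1)
  have hu : ∀ u : n → ℂ, star u = u → u ⬝ᵥ u = 1 → (u ⬝ᵥ S *ᵥ u).im = 0 := by
    intro u hu huu
    have h2 := trace_mul_im_eq_zero_of_isMax (H := 1 - (2 : ℂ) • vecMulVec u u) hmax
      (by simp [conjTranspose_sub, conjTranspose_smul, conjTranspose_vecMulVec, hu])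
      (by simp [transpose_sub, transpose_smul, transpose_vecMulVec])
      (by
        simp only [sub_mul, mul_sub, one_mul, mul_one, smul_mul_smul_comm, vecMulVec_mul_vecMulVec,
          huu, one_smul]
        module)
    have e : (S * vecMulVec u u).trace = u ⬝ᵥ S *ᵥ u := by
      rw [mul_vecMulVec, trace_vecMulVec, dotProduct_comm]
    rw [mul_sub, mul_one, Matrix.mul_smul, trace_sub, trace_smul, e, Complex.sub_im, h1] at h2
    simpa using h2
  have hdiag : ∀ i, (S i i).im = 0 := fun i => by
    simpa [Matrix.mulVec_single] using hu (Pi.single i 1) (by ext k; simp [Pi.single_apply]) (by simp)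
  by_cases hij : i = j
  · rw [hij]; exact hdiag j
  -- `3 / 5, 4 / 5` is a rational point of the circle, which makes `u` a unit vector
  have h := hu (Pi.single i (3 / 5) + Pi.single j (4 / 5))
    (by
      ext k
      simp only [Pi.star_apply, Pi.add_apply, Pi.single_apply]
      split_ifs <;> simp)
    (by
      simp [dotProduct_add, hij, Ne.symm hij]
      norm_num)
  have hs : S j i = S i j := hS.apply i j
  simp [add_dotProduct, mulVec_add, Matrix.mulVec_single, hs, hdiag] at h
  linarith

/-- **Takagi factorization**: a complex symmetric matrix is unitarily congruent to a nonnegative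
diagonal matrix. -/
lemma exists_takagi {n : Type*} [Fintype n] [DecidableEq n] (T : Matrix n n ℂ) (hT : T.IsSymm) :
    ∃ V ∈ unitaryGroup n ℂ, ∃ s : n → ℝ, (∀ i, 0 ≤ s i) ∧
      Vᵀ * T * V = diagonal fun i => (s i : ℂ) := by
  obtain ⟨V, hV, hmax⟩ := (isCompact_unitaryGroup n).exists_isMaxOn ⟨1, one_mem _⟩
    (f := fun V => (Vᵀ * T * V).trace.re) (by fun_prop)
  set S := Vᵀ * T * V with hSdef
  have hS : S.IsSymm := by
    simp only [IsSymm, hSdef, transpose_mul, transpose_transpose, hT.eq, mul_assoc]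
  have hre : ∀ i j, (S i j).im = 0 := im_eq_zero_of_isMax hS fun Z hZ => by
    have := hmax (mul_mem hV hZ)
    simpa [hSdef, transpose_mul, mul_assoc] using this
  set A : Matrix n n ℝ := S.map Complex.re with hA
  have hAS : S = A.map Complex.ofReal := by
    ext i j
    apply Complex.ext <;> simp [hA, hre]
  have hAh : A.IsHermitian := by
    ext i j
    simp [hA, hS.apply i j]
  set O : Matrix n n ℝ := ↑hAh.eigenvectorUnitary with hO
  have hOu : Oᵀ * O = 1 := by
    simpa [star_eq_conjTranspose] using mem_unitaryGroup_iff'.1 hAh.eigenvectorUnitary.2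
  have hOA : Oᵀ * A * O = diagonal hAh.eigenvalues := by
    have := hAh.conjStarAlgAut_star_eigenvectorUnitary
    rw [Unitary.conjStarAlgAut_star_apply] at this
    simpa [star_eq_conjTranspose] using this
  set e : n → ℂ := fun i => if 0 ≤ hAh.eigenvalues i then 1 else Complex.I with he
  have hee : ∀ i, star (e i) * e i = 1 := fun i => by
    simp only [he]; split_ifs <;> simp
  have hOC : (O.map Complex.ofReal) ∈ unitaryGroup n ℂ := by
    rw [mem_unitaryGroup_iff', star_eq_conjTranspose]
    have : (O.map Complex.ofReal)ᴴ = Oᵀ.map Complex.ofReal := by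
      ext i j; simp
    rw [this]
    have := congrArg (fun M : Matrix n n ℝ => M.map Complex.ofRealHom) hOu
    simp only [Matrix.map_mul] at this
    exact this.trans (Matrix.map_one _ (map_zero _) (map_one _))
  have heu : diagonal e ∈ unitaryGroup n ℂ := by
    rw [mem_unitaryGroup_iff', star_eq_conjTranspose, diagonal_conjTranspose, diagonal_mul_diagonal]
    simp only [Pi.star_apply, hee, diagonal_one]
  refine ⟨V * O.map Complex.ofReal * diagonal e, mul_mem (mul_mem hV hOC) heu,
    fun i => |hAh.eigenvalues i|, fun i => abs_nonneg _, ?_⟩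
  have h1 : (O.map Complex.ofReal)ᵀ * S * O.map Complex.ofReal
      = diagonal fun i => (hAh.eigenvalues i : ℂ) := by
    have := congrArg (fun M : Matrix n n ℝ => M.map Complex.ofRealHom) hOA
    rw [hAS]
    simp only [Matrix.map_mul] at this
    refine Eq.trans ?_ (this.trans ?_)
    · rw [transpose_map]; rfl
    · rw [diagonal_map (map_zero _)]; rfl
  calc _ = diagonal e * ((O.map Complex.ofReal)ᵀ * S * O.map Complex.ofReal) * diagonal e := by
        simp only [hSdef, transpose_mul, diagonal_transpose, mul_assoc]
    _ = _ := by
        rw [h1, diagonal_mul_diagonal, diagonal_mul_diagonal]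
        congr 1
        ext i
        simp only [he]
        split_ifs with h
        · simp [abs_of_nonneg h]
        · rw [abs_of_neg (not_le.1 h)]
          push_cast
          linear_combination (hAh.eigenvalues i : ℂ) * Complex.I_sq

/-! ### Anticommuting square roots of `-1` and orthonormal bases of a qubit -/

lemma mul_self_of_trace_eq_zero {M : Matrix (Fin 2) (Fin 2) ℂ} (h : M.trace = 0) :
    M * M = -M.det • (1 : Matrix (Fin 2) (Fin 2) ℂ) := by
  rw [trace_fin_two] at h
  have h1 : M 1 1 = -M 0 0 := by linear_combination h
  ext i j
  fin_cases i <;> fin_cases j <;> simp [mul_apply, det_fin_two, h1] <;> ring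

lemma mul_add_mul_of_trace_eq_zero {M N : Matrix (Fin 2) (Fin 2) ℂ} (hM : M.trace = 0)
    (hN : N.trace = 0) : M * N + N * M = (M * N).trace • (1 : Matrix (Fin 2) (Fin 2) ℂ) := by
  rw [trace_fin_two] at hM hN
  have h1 : M 1 1 = -M 0 0 := by linear_combination hM
  have h2 : N 1 1 = -N 0 0 := by linear_combination hN
  ext i j
  fin_cases i <;> fin_cases j <;> simp [mul_apply, trace_fin_two, h1, h2] <;> ring

lemma adjugate_of_trace_eq_zero {M : Matrix (Fin 2) (Fin 2) ℂ} (h : M.trace = 0) :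
    M.adjugate = -M := by
  rw [trace_fin_two] at h
  rw [adjugate_fin_two]
  ext i j
  fin_cases i <;> fin_cases j <;> simp
  · linear_combination h
  · linear_combination h

/-- Any three anticommuting square roots of `-1` among the `2 × 2` matrices are simultaneously
similar to a standard triple. The columns of `h` are an eigenvector `v` of the first matrix and its
image under the second. -/
lemma exists_standard_form {a b c : Matrix (Fin 2) (Fin 2) ℂ}
    (hat : a.trace = 0) (had : a.det = 1) (hb : b * b = -1) (hc : c * c = -1)
    (hab : a * b + b * a = 0) (hac : a * c + c * a = 0) (hbc : b * c + c * b = 0) :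
    ∃ (h : Matrix (Fin 2) (Fin 2) ℂ) (z : ℂ), IsUnit h.det ∧ z ^ 2 = -1 ∧
      a * h = h * !![Complex.I, 0; 0, -Complex.I] ∧ b * h = h * !![0, -1; 1, 0] ∧
      c * h = h * !![0, z; z, 0] := by
  obtain ⟨v, hv0, hv⟩ : ∃ v ≠ 0, (a - Complex.I • (1 : Matrix (Fin 2) (Fin 2) ℂ)) *ᵥ v = 0 := by
    rw [exists_mulVec_eq_zero_iff]
    rw [trace_fin_two] at hat
    rw [det_fin_two] at had ⊢
    simp
    linear_combination had - Complex.I * hat + Complex.I_sq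
  have hav : a *ᵥ v = Complex.I • v := by
    rw [sub_mulVec, smul_mulVec, one_mulVec, sub_eq_zero] at hv
    exact hv
  set u := b *ᵥ v with hu
  have hbu : b *ᵥ u = -v := by rw [hu, mulVec_mulVec, hb, neg_mulVec, one_mulVec]
  have hau : a *ᵥ u = -Complex.I • u := by
    rw [hu, mulVec_mulVec, eq_neg_of_add_eq_zero_left hab, neg_mulVec, ← mulVec_mulVec, hav,
      mulVec_smul, neg_smul]
  have hu0 : u ≠ 0 := by
    intro h
    rw [h, mulVec_zero] at hbu
    exact hv0 (neg_eq_zero.1 hbu.symm)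
  set h : Matrix (Fin 2) (Fin 2) ℂ := !![v 0, u 0; v 1, u 1] with hh
  have hmul : ∀ x : Fin 2 → ℂ, h *ᵥ x = x 0 • v + x 1 • u := by
    intro x
    ext i
    fin_cases i <;> simp [hh, mulVec, dotProduct, Fin.sum_univ_two] <;> ring
  have hdet : h.det ≠ 0 := by
    rw [Ne, ← exists_mulVec_eq_zero_iff]
    rintro ⟨x, hx0, hx⟩
    rw [hmul] at hx
    have hx' := congrArg (a *ᵥ ·) hx
    simp only [mulVec_add, mulVec_smul, hav, hau, mulVec_zero] at hx'
    have h1 : x 0 • v = 0 := by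
      have : (2 * Complex.I) • (x 0 • v) = 0 := by
        linear_combination (norm := module) hx' + Complex.I • hx
      exact (smul_eq_zero.1 this).resolve_left (by simp)
    rw [h1, zero_add] at hx
    apply hx0
    ext i
    fin_cases i
    · exact (smul_eq_zero.1 h1).resolve_right hv0
    · exact (smul_eq_zero.1 hx).resolve_right hu0
  have hunit : IsUnit h.det := isUnit_iff_ne_zero.2 hdet
  have hah : a * h = h * !![Complex.I, 0; 0, -Complex.I] := by
    have h0 := congrFun hav
    have h1 := congrFun hau
    simp only [mulVec, dotProduct, Fin.sum_univ_two, Pi.smul_apply, smul_eq_mul] at h0 h1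
    ext i j
    fin_cases i <;> fin_cases j <;> simp [hh, mul_apply, Fin.sum_univ_two, h0, h1] <;> ring
  have hbh : b * h = h * !![0, -1; 1, 0] := by
    have h0 := congrFun hu
    have h1 := congrFun hbu
    simp only [mulVec, dotProduct, Fin.sum_univ_two, Pi.neg_apply] at h0 h1
    ext i j
    fin_cases j
    · fin_cases i <;> simp [hh, mul_apply, Fin.sum_univ_two, h0]
    · fin_cases i <;> simp [hh, mul_apply, Fin.sum_univ_two, h1]
  set d := h⁻¹ * c * h with hd
  have hcd : c * h = h * d := by
    rw [hd, ← mul_assoc, ← mul_assoc, mul_nonsing_inv _ hunit, one_mul]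
  clear_value d
  have cancel : ∀ {x y : Matrix (Fin 2) (Fin 2) ℂ}, h * x = h * y → x = y := fun {x y} e => by
    have := congrArg (h⁻¹ * ·) e
    simpa [← mul_assoc, nonsing_inv_mul _ hunit] using this
  have had' : !![Complex.I, 0; 0, -Complex.I] * d + d * !![Complex.I, 0; 0, -Complex.I] = 0 := by
    apply cancel
    rw [mul_add, ← mul_assoc, ← mul_assoc, ← hah, ← hcd, mul_assoc, mul_assoc, ← hcd, ← hah,
      ← mul_assoc, ← mul_assoc, ← add_mul, hac, zero_mul, mul_zero]
  have hbd' : !![0, -1; 1, 0] * d + d * !![0, -1; 1, 0] = 0 := by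
    apply cancel
    rw [mul_add, ← mul_assoc, ← mul_assoc, ← hbh, ← hcd, mul_assoc, mul_assoc, ← hcd, ← hbh,
      ← mul_assoc, ← mul_assoc, ← add_mul, hbc, zero_mul, mul_zero]
  have hdd : d * d = -1 := by
    apply cancel
    rw [← mul_assoc, ← hcd, mul_assoc, ← hcd, ← mul_assoc, hc, mul_neg, neg_mul, one_mul, mul_one]
  have e00 := congrFun (congrFun had' 0) 0
  have e11 := congrFun (congrFun had' 1) 1
  have f00 := congrFun (congrFun hbd' 0) 0
  have g00 := congrFun (congrFun hdd 0) 0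
  simp [mul_apply, Fin.sum_univ_two, vecMul, dotProduct] at e00 e11 f00 g00
  have d00 : d 0 0 = 0 := by
    have : 2 * Complex.I * d 0 0 = 0 := by linear_combination e00
    simpa using this
  have d11 : d 1 1 = 0 := by
    have : 2 * Complex.I * d 1 1 = 0 := by linear_combination -e11
    simpa using this
  have d01 : d 1 0 = d 0 1 := by linear_combination -f00
  refine ⟨h, d 0 1, hunit, ?_, hah, hbh, ?_⟩
  · rw [d01, d00] at g00
    linear_combination g00
  · rw [hcd]
    congr 1
    ext i j
    fin_cases i <;> fin_cases j <;> simp [d00, d11, d01]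

/-- The observable `|w₀⟩⟨w₀| - |w₁⟩⟨w₁|` of the orthonormal basis formed by the columns of `W`. -/
noncomputable def basisObservable (W : Matrix (Fin 2) (Fin 2) ℂ) : Matrix (Fin 2) (Fin 2) ℂ :=
  W * !![1, 0; 0, -1] * Wᴴ

lemma basisObservable_isHermitian (W : Matrix (Fin 2) (Fin 2) ℂ) :
    (basisObservable W).IsHermitian := by
  have : (!![1, 0; 0, -1] : Matrix (Fin 2) (Fin 2) ℂ)ᴴ = !![1, 0; 0, -1] := by
    ext i j
    fin_cases i <;> fin_cases j <;> simp
  simp only [basisObservable, IsHermitian, conjTranspose_mul, conjTranspose_conjTranspose, this,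
    mul_assoc]

lemma det_basisObservable {W : Matrix (Fin 2) (Fin 2) ℂ} (hW : W ∈ unitaryGroup (Fin 2) ℂ) :
    (basisObservable W).det = -1 := by
  have h : Wᴴ * W = 1 := mem_unitaryGroup_iff'.1 hW
  have h' : Wᴴ.det * W.det = 1 := by rw [← det_mul, h, det_one]
  rw [basisObservable, det_mul, det_mul, det_fin_two_of]
  linear_combination -h'

/-- A basis that is unbiased with respect to an eigenbasis of `kᴴ k`. -/
lemma exists_trace_mul_basisObservable_eq_zero (k : Matrix (Fin 2) (Fin 2) ℂ) :
    ∃ W ∈ unitaryGroup (Fin 2) ℂ, (k * basisObservable W * kᴴ).trace = 0 := by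
  have hM : (kᴴ * k).IsHermitian := isHermitian_conjTranspose_mul_self k
  set U : Matrix (Fin 2) (Fin 2) ℂ := ↑hM.eigenvectorUnitary with hU
  have hUD : Uᴴ * (kᴴ * k) * U = diagonal (RCLike.ofReal ∘ hM.eigenvalues) := by
    have := hM.conjStarAlgAut_star_eigenvectorUnitary
    rw [Unitary.conjStarAlgAut_star_apply] at this
    simpa [star_eq_conjTranspose] using this
  set t : ℂ := Complex.ofReal (Real.sqrt 2)⁻¹ with ht
  have htt : t * t = 1 / 2 := by
    rw [ht, ← Complex.ofReal_mul, ← mul_inv, Real.mul_self_sqrt (by norm_num)]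
    norm_num
  have hts : (starRingEnd ℂ) t = t := Complex.conj_ofReal _
  set F : Matrix (Fin 2) (Fin 2) ℂ := !![t, t; t, -t] with hF
  have hFF : Fᴴ = F := by
    ext i j
    fin_cases i <;> fin_cases j <;> simp [hF, hts]
  have hFu : F ∈ unitaryGroup (Fin 2) ℂ := by
    rw [mem_unitaryGroup_iff', star_eq_conjTranspose, hFF]
    ext i j
    fin_cases i <;> fin_cases j <;> simp [hF, htt] <;> norm_num
  have hFs : F * !![1, 0; 0, -1] * F = !![0, 1; 1, 0] := by
    ext i j
    fin_cases i <;> fin_cases j <;> simp [hF, htt] <;> norm_num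
  refine ⟨U * F, mul_mem hM.eigenvectorUnitary.2 hFu, ?_⟩
  have e : basisObservable (U * F) = U * !![0, 1; 1, 0] * Uᴴ := by
    rw [← hFs, basisObservable, conjTranspose_mul, hFF]
    simp only [mul_assoc]
  rw [trace_mul_comm, ← mul_assoc, e, ← mul_assoc, trace_mul_comm, ← mul_assoc, ← mul_assoc,
    ← mul_assoc, mul_assoc Uᴴ, hUD]
  simp [trace_fin_two, mul_apply, Fin.sum_univ_two]

/-- The Bell-diagonal case: on traceless Hermitian matrices the map
`y ↦ s₀ y + ∑ sⱼ eⱼ y eⱼᴴ` is diagonal in the Pauli basis. -/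
lemma det_pauli_sum {y : Matrix (Fin 2) (Fin 2) ℂ} (hy : y.IsHermitian) (hyt : y.trace = 0)
    {z : ℂ} (hz : z ^ 2 = -1) (s₀ s₁ s₂ s₃ : ℝ) :
    (((s₀ : ℂ) • y +
      (s₁ : ℂ) • (!![Complex.I, 0; 0, -Complex.I] * y * !![Complex.I, 0; 0, -Complex.I]ᴴ) +
      (s₂ : ℂ) • (!![0, -1; 1, 0] * y * !![0, -1; 1, 0]ᴴ) +
      (s₃ : ℂ) • (!![0, z; z, 0] * y * !![0, z; z, 0]ᴴ)).det).re =
    -((s₀ + s₁ - s₂ - s₃) ^ 2 * (y 0 0).re ^ 2 + (s₀ - s₁ - s₂ + s₃) ^ 2 * (y 0 1).re ^ 2 +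
      (s₀ - s₁ + s₂ - s₃) ^ 2 * (y 0 1).im ^ 2) := by
  have hzz : z * (starRingEnd ℂ) z = 1 := by
    have h : ‖z‖ ^ 2 = 1 := by rw [← norm_pow, hz, norm_neg, norm_one]
    rw [Complex.mul_conj, Complex.normSq_eq_norm_sq, h, Complex.ofReal_one]
  have h10 : y 1 0 = (starRingEnd ℂ) (y 0 1) := (hy.apply 1 0).symm
  have h00 : y 0 0 = ((y 0 0).re : ℂ) := (Complex.conj_eq_iff_re.1 (hy.apply 0 0)).symm
  have h11 : y 1 1 = -((y 0 0).re : ℂ) := by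
    rw [trace_fin_two] at hyt
    rw [← h00]
    linear_combination hyt
  have e3 : !![0, z; z, 0] * y * !![0, z; z, 0]ᴴ = !![y 1 1, y 1 0; y 0 1, y 0 0] := by
    ext i j
    fin_cases i <;> fin_cases j <;> simp [mul_apply, Fin.sum_univ_two, vecMul, dotProduct]
    · linear_combination y 1 1 * hzz
    · linear_combination y 1 0 * hzz
    · linear_combination y 0 1 * hzz
    · linear_combination y 0 0 * hzz
  have e2 : !![0, -1; 1, 0] * y * (!![0, -1; 1, 0] : Matrix (Fin 2) (Fin 2) ℂ)ᴴ
      = !![y 1 1, -y 1 0; -y 0 1, y 0 0] := by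
    ext i j
    fin_cases i <;> fin_cases j <;> simp [mul_apply, Fin.sum_univ_two, vecMul, dotProduct]
  have e1 : !![Complex.I, 0; 0, -Complex.I] * y * !![Complex.I, 0; 0, -Complex.I]ᴴ
      = !![y 0 0, -y 0 1; -y 1 0, y 1 1] := by
    ext i j
    fin_cases i <;> fin_cases j <;> simp [mul_apply, Fin.sum_univ_two, vecMul, dotProduct]
    · linear_combination -y 0 0 * Complex.I_sq
    · linear_combination y 0 1 * Complex.I_sq
    · linear_combination y 1 0 * Complex.I_sq
    · linear_combination -y 1 1 * Complex.I_sq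
  rw [e1, e2, e3, det_fin_two]
  generalize (y 0 0).re = p at *
  simp [h10, h11, h00]
  ring

/-! ### Families orthogonal for the determinant -/

/-- Four `2 × 2` matrices that are orthogonal for the polarised determinant are, up to a common
left factor `g` and scalars, the four standard matrices of `exists_standard_form` conjugated by one
matrix `h`. Let `Y` be the observable of a basis that is unbiased with respect to an eigenbasis of
`(h hᴴ)⁻¹`. Then `h⁻¹ Y h⁻ᴴ` is traceless, so by `det_pauli_sum` the right side is a convex
combination of three squares of signed sums of the `s j`, and the least of these is at most it. -/
lemma exists_basis_sq_signed_sum_le {ψ : Fin 2 × Fin 2 → Matrix (Fin 2) (Fin 2) ℂ}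
    {s : Fin 2 × Fin 2 → ℝ} (hs : ∀ j, 0 < s j) (hdet : ∀ j, (ψ j).det = s j)
    (horth : ∀ i j, i ≠ j → ((ψ i).adjugate * ψ j).trace = 0) :
    ∃ W ∈ unitaryGroup (Fin 2) ℂ, ∃ ε : Fin 2 × Fin 2 → ℝ, (∀ j, ε j = 1 ∨ ε j = -1) ∧
      (∑ j, ε j * s j) ^ 2 ≤ -(∑ j, ψ j * basisObservable W * (ψ j)ᴴ).det.re := by
  set g := ψ (0, 0) with hg
  set s₀ := s (0, 0) with hs₀
  have hs₀p : 0 < s₀ := hs _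
  have hgd : g.det = s₀ := hdet _
  set c : Fin 2 × Fin 2 → ℝ := fun j => (Real.sqrt (s₀ * s j))⁻¹ with hc
  have hcc : ∀ j, (c j : ℂ) * c j * (s₀ * s j) = 1 := fun j => by
    have h : 0 < s₀ * s j := mul_pos hs₀p (hs j)
    have : c j * c j * (s₀ * s j) = 1 := by
      rw [hc]
      simp only
      rw [← mul_inv, Real.mul_self_sqrt h.le, inv_mul_cancel₀ h.ne']
    exact_mod_cast this
  set τ : Fin 2 × Fin 2 → Matrix (Fin 2) (Fin 2) ℂ := fun j => (c j : ℂ) • (g.adjugate * ψ j)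
    with hτ
  have hτt : ∀ j, j ≠ (0, 0) → (τ j).trace = 0 := fun j hj => by
    simp only [hτ, trace_smul]
    rw [horth _ _ hj.symm, smul_zero]
  have hτd : ∀ j, (τ j).det = 1 := fun j => by
    simp only [hτ, det_smul, det_mul, Fintype.card_fin, det_adjugate, hgd, hdet j]
    linear_combination hcc j
  have hτsq : ∀ j, j ≠ (0, 0) → τ j * τ j = -1 := fun j hj => by
    rw [mul_self_of_trace_eq_zero (hτt j hj), hτd, neg_smul, one_smul]
  have hτanti : ∀ i j, i ≠ (0, 0) → j ≠ (0, 0) → i ≠ j → τ i * τ j + τ j * τ i = 0 := by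
    intro i j hi hj hij
    rw [mul_add_mul_of_trace_eq_zero (hτt i hi) (hτt j hj)]
    have h1 : τ i = -(τ i).adjugate := by rw [adjugate_of_trace_eq_zero (hτt i hi), neg_neg]
    have h2 : (τ i).adjugate = (c i : ℂ) • ((ψ i).adjugate * g) := by
      simp only [hτ, adjugate_smul, adjugate_mul_distrib, Fintype.card_fin]
      rw [adjugate_adjugate _ (by simp)]
      simp
    have h3 : (τ i * τ j).trace = 0 := by
      rw [h1, h2]
      simp only [hτ, neg_mul, trace_neg, smul_mul_smul_comm, trace_smul]
      rw [mul_assoc, ← mul_assoc g, mul_adjugate, smul_mul, one_mul, Matrix.mul_smul, trace_smul,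
        horth i j hij]
      simp
    rw [h3, zero_smul]
  obtain ⟨h, z, hh, hz, h1, h2, h3⟩ := exists_standard_form (a := τ (0, 1)) (b := τ (1, 0))
    (c := τ (1, 1)) (hτt _ (by decide)) (hτd _) (hτsq _ (by decide)) (hτsq _ (by decide))
    (hτanti _ _ (by decide) (by decide) (by decide))
    (hτanti _ _ (by decide) (by decide) (by decide))
    (hτanti _ _ (by decide) (by decide) (by decide))
  obtain ⟨W, hW, hWt⟩ := exists_trace_mul_basisObservable_eq_zero h⁻¹
  set Y := basisObservable W with hY
  set y := h⁻¹ * Y * h⁻¹ᴴ with hy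
  have hyh : y.IsHermitian := isHermitian_mul_mul_conjTranspose _ (basisObservable_isHermitian W)
  have hYy : Y = h * y * hᴴ := by
    have e : h⁻¹ᴴ * hᴴ = 1 := by
      rw [← conjTranspose_mul, mul_nonsing_inv _ hh, conjTranspose_one]
    calc Y = (h * h⁻¹) * Y * (h⁻¹ᴴ * hᴴ) := by rw [e, mul_nonsing_inv _ hh, one_mul, mul_one]
      _ = h * y * hᴴ := by simp only [hy, mul_assoc]
  clear_value y
  have hterm : ∀ j (e : Matrix (Fin 2) (Fin 2) ℂ), τ j * h = h * e →
      ψ j * Y * (ψ j)ᴴ = (s₀⁻¹ : ℂ) • ((g * h) * ((s j : ℂ) • (e * y * eᴴ)) * (g * h)ᴴ) := by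
    intro j e he
    have hψ : ψ j * h = ((c j : ℂ) * s j) • (g * h * e) := by
      rw [mul_assoc g, ← he, ← mul_assoc g]
      simp only [hτ, Matrix.mul_smul]
      rw [← mul_assoc, mul_adjugate, hgd, smul_mul_assoc, smul_mul_assoc, one_mul, smul_smul,
        smul_mul_assoc, smul_smul]
      have : (c j : ℂ) * s j * c j * s₀ = 1 := by linear_combination hcc j
      rw [this, one_smul]
    have : ψ j * Y * (ψ j)ᴴ = (ψ j * h) * y * (ψ j * h)ᴴ := by
      rw [hYy, conjTranspose_mul]
      simp only [mul_assoc]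
    rw [this, hψ]
    simp only [conjTranspose_smul, conjTranspose_mul, smul_mul, Matrix.mul_smul, smul_smul,
      mul_assoc]
    congr 1
    have hs0 : (s₀ : ℂ) ≠ 0 := by exact_mod_cast hs₀p.ne'
    have e1 : star ((c j : ℂ) * s j) = c j * s j := by simp
    rw [e1]
    field_simp
    linear_combination (s j : ℂ) * hcc j
  have hX : ∑ j, ψ j * Y * (ψ j)ᴴ = (s₀⁻¹ : ℂ) • ((g * h) *
      ((s₀ : ℂ) • y +
      (s (0, 1) : ℂ) • (!![Complex.I, 0; 0, -Complex.I] * y * !![Complex.I, 0; 0, -Complex.I]ᴴ) +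
      (s (1, 0) : ℂ) • (!![0, -1; 1, 0] * y * !![0, -1; 1, 0]ᴴ) +
      (s (1, 1) : ℂ) • (!![0, z; z, 0] * y * !![0, z; z, 0]ᴴ)) * (g * h)ᴴ) := by
    have h0 : τ (0, 0) * h = h * 1 := by
      have : τ (0, 0) = 1 := by
        simp only [hτ, ← hg]
        rw [adjugate_mul, hgd, smul_smul]
        have hs0 : Real.sqrt (s₀ * s₀) = s₀ := Real.sqrt_mul_self hs₀p.le
        simp only [hc, ← hs₀, hs0]
        rw [Complex.ofReal_inv, inv_mul_cancel₀ (by exact_mod_cast hs₀p.ne'), one_smul]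
      rw [this, one_mul, mul_one]
    rw [Fintype.sum_prod_type]
    simp only [Fin.sum_univ_two]
    rw [hterm _ _ h0, hterm _ _ h1, hterm _ _ h2, hterm _ _ h3]
    simp only [mul_add, add_mul, smul_add, conjTranspose_one, one_mul, mul_one, ← hs₀, add_assoc]
  set D := ((s₀ : ℂ) • y +
      (s (0, 1) : ℂ) • (!![Complex.I, 0; 0, -Complex.I] * y * !![Complex.I, 0; 0, -Complex.I]ᴴ) +
      (s (1, 0) : ℂ) • (!![0, -1; 1, 0] * y * !![0, -1; 1, 0]ᴴ) +
      (s (1, 1) : ℂ) • (!![0, z; z, 0] * y * !![0, z; z, 0]ᴴ)) with hD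
  have hDre := det_pauli_sum hyh hWt hz s₀ (s (0, 1)) (s (1, 0)) (s (1, 1))
  rw [← hD] at hDre
  set N : ℝ := Complex.normSq h.det with hN
  have hNpos : 0 < N := Complex.normSq_pos.2 (isUnit_iff_ne_zero.1 hh)
  have hNC : h.det * star h.det = N := Complex.mul_conj _
  have hXdet : (∑ j, ψ j * Y * (ψ j)ᴴ).det.re = N * D.det.re := by
    have : (∑ j, ψ j * Y * (ψ j)ᴴ).det = N * D.det := by
      rw [hX]
      simp only [det_smul, det_mul, det_conjTranspose, Fintype.card_fin, hgd, star_mul']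
      rw [← hNC]
      have hs0 : (s₀ : ℂ) ≠ 0 := by exact_mod_cast hs₀p.ne'
      have e1 : star (s₀ : ℂ) = s₀ := Complex.conj_ofReal _
      rw [e1]
      field_simp
    rw [this, Complex.re_ofReal_mul]
  have hydet : N * ((y 0 0).re ^ 2 + (y 0 1).re ^ 2 + (y 0 1).im ^ 2) = 1 := by
    have hz0 := det_pauli_sum hyh hWt hz 1 0 0 0
    simp only [Complex.ofReal_one, one_smul, Complex.ofReal_zero, zero_smul, add_zero] at hz0
    have e : (N : ℂ) * y.det = -1 := by
      rw [← det_basisObservable hW, ← hY, hYy, det_mul, det_mul, det_conjTranspose, ← hNC]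
      ring
    have e' := congrArg Complex.re e
    rw [Complex.re_ofReal_mul, hz0] at e'
    simp at e'
    linear_combination -e'
  refine ⟨W, hW, ?_⟩
  rw [hXdet, hDre]
  set P := (y 0 0).re ^ 2
  set Q := (y 0 1).re ^ 2
  set R := (y 0 1).im ^ 2
  have hP : 0 ≤ N * P := mul_nonneg hNpos.le (sq_nonneg _)
  have hQ : 0 ≤ N * Q := mul_nonneg hNpos.le (sq_nonneg _)
  have hR : 0 ≤ N * R := mul_nonneg hNpos.le (sq_nonneg _)
  rw [mul_neg, neg_neg]
  set t₁ := (s₀ + s (0, 1) - s (1, 0) - s (1, 1)) ^ 2 with ht₁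
  set t₂ := (s₀ - s (0, 1) - s (1, 0) + s (1, 1)) ^ 2 with ht₂
  set t₃ := (s₀ - s (0, 1) + s (1, 0) - s (1, 1)) ^ 2 with ht₃
  -- the smallest of the three squares is at most their weighted mean
  have hmin : min t₁ (min t₂ t₃) ≤ N * (t₁ * P + t₂ * Q + t₃ * R) := by
    have m1 := mul_le_mul_of_nonneg_right (min_le_left t₁ (min t₂ t₃)) hP
    have m2 := mul_le_mul_of_nonneg_right
      ((min_le_right t₁ (min t₂ t₃)).trans (min_le_left t₂ t₃)) hQ
    have m3 := mul_le_mul_of_nonneg_right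
      ((min_le_right t₁ (min t₂ t₃)).trans (min_le_right t₂ t₃)) hR
    linear_combination m1 + m2 + m3 - min t₁ (min t₂ t₃) * hydet
  have hε : ∀ p : Fin 2 × Fin 2 → Prop, [DecidablePred p] → ∀ j,
      (if p j then (1 : ℝ) else -1) = 1 ∨ (if p j then (1 : ℝ) else -1) = -1 := fun p _ j => by
    split_ifs <;> simp
  rcases min_choice t₁ (min t₂ t₃) with h | h
  · refine ⟨_, hε fun j => j.1 = 0, le_trans (le_of_eq ?_) (h ▸ hmin)⟩
    simp [Fintype.sum_prod_type, Fin.sum_univ_two, ← hs₀, ht₁]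
    ring
  rw [h] at hmin
  rcases min_choice t₂ t₃ with h | h
  · refine ⟨_, hε fun j => j.1 = j.2, le_trans (le_of_eq ?_) (h ▸ hmin)⟩
    simp [Fintype.sum_prod_type, Fin.sum_univ_two, ← hs₀, ht₂]
    ring
  · refine ⟨_, hε fun j => j.2 = 0, le_trans (le_of_eq ?_) (h ▸ hmin)⟩
    simp [Fintype.sum_prod_type, Fin.sum_univ_two, ← hs₀, ht₃]
    ring

/-! ### Two-qubit ensembles -/

/-- The coefficient matrix of a bipartite vector. -/
def coeffMatrix {A B : Type*} (φ : A × B → ℂ) : Matrix A B ℂ :=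
  of fun a b => φ (a, b)

/-- The spin flip `σ_y ⊗ σ_y` of two qubits, up to sign. -/
def spinFlip : Matrix (Fin 2 × Fin 2) (Fin 2 × Fin 2) ℂ :=
  kroneckerMap (· * ·) !![0, 1; -1, 0] !![0, 1; -1, 0]

/-- The operator `tr_B ((1 ⊗ Yᵀ) ρ)` on the first factor. -/
def partialExpectation {A B : Type*} [Fintype B] (ρ : Matrix (A × B) (A × B) ℂ)
    (Y : Matrix B B ℂ) : Matrix A A ℂ :=
  of fun a a' => ∑ b, ∑ b', Y b b' * ρ (a, b) (a', b')

lemma spinFlip_isSymm : spinFlip.IsSymm := by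
  ext ⟨a, b⟩ ⟨a', b'⟩
  fin_cases a <;> fin_cases b <;> fin_cases a' <;> fin_cases b' <;> simp [spinFlip]

lemma spinFlip_mul_self : spinFlip * spinFlip = 1 := by
  have h : (!![0, 1; -1, 0] : Matrix (Fin 2) (Fin 2) ℂ) * !![0, 1; -1, 0] = -1 := by
    ext i j
    fin_cases i <;> fin_cases j <;> simp
  have := (mul_kronecker_mul (!![0, 1; -1, 0] : Matrix (Fin 2) (Fin 2) ℂ) !![0, 1; -1, 0]
    (!![0, 1; -1, 0] : Matrix (Fin 2) (Fin 2) ℂ) !![0, 1; -1, 0]).symm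
  refine Eq.trans this ?_
  rw [h]
  ext ⟨a, b⟩ ⟨a', b'⟩
  fin_cases a <;> fin_cases b <;> fin_cases a' <;> fin_cases b' <;>
    simp [one_apply]

lemma dotProduct_spinFlip_mulVec (x y : Fin 2 × Fin 2 → ℂ) :
    x ⬝ᵥ spinFlip *ᵥ y = ((coeffMatrix x).adjugate * coeffMatrix y).trace := by
  simp [dotProduct, mulVec, spinFlip, Fintype.sum_prod_type, Fin.sum_univ_two, adjugate_fin_two,
    coeffMatrix, trace_fin_two, vecHead, vecTail]
  ring

lemma dotProduct_spinFlip_mulVec_self (x : Fin 2 × Fin 2 → ℂ) :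
    x ⬝ᵥ spinFlip *ᵥ x = 2 * (coeffMatrix x).det := by
  rw [dotProduct_spinFlip_mulVec, adjugate_mul, trace_smul, trace_one]
  simp
  ring

lemma transpose_mul_mul_apply {m n : Type*} [Fintype m] (R : Matrix m n ℂ) (M : Matrix m m ℂ)
    (i j : n) : (Rᵀ * M * R) i j = R.col i ⬝ᵥ M *ᵥ R.col j := by
  rw [Matrix.mul_assoc]
  simp only [dotProduct, mulVec, mul_apply, transpose_apply, col_apply]

lemma sum_coeffMatrix_mul_mul {A B ι : Type*} [Fintype B] [Fintype ι] (R : Matrix (A × B) ι ℂ)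
    (Y : Matrix B B ℂ) :
    ∑ j, coeffMatrix (R.col j) * Y * (coeffMatrix (R.col j))ᴴ = partialExpectation (R * Rᴴ) Y := by
  ext a a'
  simp only [Matrix.sum_apply, mul_apply, partialExpectation, of_apply, coeffMatrix, col_apply,
    conjTranspose_apply, Finset.sum_mul, Finset.mul_sum]
  rw [Finset.sum_comm]
  conv_rhs => rw [Finset.sum_comm]
  refine Finset.sum_congr rfl fun b' _ => ?_
  conv_lhs => rw [Finset.sum_comm]
  refine Finset.sum_congr rfl fun b _ => Finset.sum_congr rfl fun j _ => by ring

lemma sum_ketBra_transpose {m ι : Type*} [Fintype ι] (R : Matrix m ι ℂ) :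
    ∑ j, ketBra (R.col j) = R * Rᴴ := by
  ext x y
  simp [Matrix.sum_apply, ketBra, vecMulVec_apply, mul_apply]

/-- If `R` is invertible, so is the symmetric matrix `Rᵀ Θ R`, and its Takagi factorization has
positive entries. The signs of `exists_basis_sq_signed_sum_le` are absorbed into `V`. -/
lemma exists_isDiag_trace_le_of_isUnit {R : Matrix (Fin 2 × Fin 2) (Fin 2 × Fin 2) ℂ}
    (hR : IsUnit R) :
    ∃ V ∈ unitaryGroup (Fin 2 × Fin 2) ℂ, ∃ W ∈ unitaryGroup (Fin 2) ℂ,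
      (Vᵀ * (Rᵀ * spinFlip * R) * V).IsDiag ∧
      ‖(Vᵀ * (Rᵀ * spinFlip * R) * V).trace‖ ^ 2 ≤
        -4 * (partialExpectation (R * Rᴴ) (basisObservable W)).det.re := by
  obtain ⟨V, hV, s, hs0, hs⟩ := exists_takagi (Rᵀ * spinFlip * R) (by
    simp only [IsSymm, transpose_mul, transpose_transpose, spinFlip_isSymm.eq, mul_assoc])
  have hsym : (R * V)ᵀ * spinFlip * (R * V) = diagonal fun i => (s i : ℂ) := by
    rw [← hs]
    simp only [transpose_mul, mul_assoc]
  have hVu : IsUnit V := (Unitary.toUnits ⟨V, hV⟩).isUnit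
  have hspos : ∀ j, 0 < s j := by
    have hu : IsUnit (diagonal fun i => (s i : ℂ)) := by
      rw [← hs]
      refine (((isUnit_transpose _).2 hVu).mul ((((isUnit_transpose _).2 hR).mul ?_).mul hR)).mul hVu
      exact IsUnit.of_mul_eq_one _ spinFlip_mul_self
    rw [isUnit_diagonal, Pi.isUnit_iff] at hu
    intro j
    refine (hs0 j).lt_of_ne' fun h => ?_
    have := hu j
    simp [h] at this
  have hform : ∀ i j, (R * V).col i ⬝ᵥ spinFlip *ᵥ (R * V).col j = if i = j then (s i : ℂ) else 0 := by
    intro i j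
    rw [← transpose_mul_mul_apply, hsym, diagonal_apply]
  obtain ⟨W, hW, ε, hε, hle⟩ := exists_basis_sq_signed_sum_le
    (ψ := fun j => coeffMatrix ((R * V).col j)) (s := fun j => s j / 2)
    (fun j => half_pos (hspos j))
    (fun j => by
      have := hform j j
      rw [dotProduct_spinFlip_mulVec_self, if_pos rfl] at this
      push_cast
      rw [← this]
      ring)
    (fun i j hij => by rw [← dotProduct_spinFlip_mulVec, hform, if_neg hij])
  have hVV : V * Vᴴ = 1 := mem_unitaryGroup_iff.1 hV
  rw [sum_coeffMatrix_mul_mul, conjTranspose_mul, mul_assoc, ← mul_assoc V, hVV, one_mul] at hle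
  set e : Fin 2 × Fin 2 → ℂ := fun i => if ε i = 1 then 1 else Complex.I with he
  have heu : diagonal e ∈ unitaryGroup (Fin 2 × Fin 2) ℂ := by
    rw [mem_unitaryGroup_iff', star_eq_conjTranspose, diagonal_conjTranspose, diagonal_mul_diagonal,
      ← diagonal_one]
    congr 1
    ext i
    simp only [he, Pi.star_apply]
    split_ifs <;> simp
  have hdiag : (V * diagonal e)ᵀ * (Rᵀ * spinFlip * R) * (V * diagonal e)
      = diagonal fun i => ((ε i * s i : ℝ) : ℂ) := by
    calc _ = diagonal e * (Vᵀ * (Rᵀ * spinFlip * R) * V) * diagonal e := by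
          simp only [transpose_mul, diagonal_transpose, mul_assoc]
      _ = _ := by
          rw [hs, diagonal_mul_diagonal, diagonal_mul_diagonal]
          congr 1
          ext i
          simp only [he]
          rcases hε i with h | h
          · simp [h]
          · rw [h, if_neg (by norm_num)]
            push_cast
            linear_combination (s i : ℂ) * Complex.I_sq
  refine ⟨V * diagonal e, mul_mem hV heu, W, hW, ?_, ?_⟩
  · rw [hdiag]
    exact isDiag_diagonal _
  · rw [hdiag, trace_diagonal, ← Complex.ofReal_sum, Complex.norm_real, Real.norm_eq_abs, sq_abs]
    have : ∑ j, ε j * (s j / 2) = (∑ j, ε j * s j) / 2 := by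
      rw [Finset.sum_div]
      exact Finset.sum_congr rfl fun _ _ => by ring
    rw [this] at hle
    linarith

lemma mem_closure_isUnit {n : Type*} [Fintype n] [DecidableEq n] (R : Matrix n n ℂ) :
    R ∈ closure {M : Matrix n n ℂ | IsUnit M} := by
  have hfin : (spectrum ℂ R).Finite := finite_spectrum R
  have hd : Dense ((spectrum ℂ R)ᶜ) := hfin.countable.dense_compl ℝ
  have hc : Continuous fun z : ℂ => R - algebraMap ℂ (Matrix n n ℂ) z := by
    simp only [Algebra.algebraMap_eq_smul_one]
    fun_prop
  have h := image_closure_subset_closure_image hc (s := (spectrum ℂ R)ᶜ) ⟨0, hd 0, rfl⟩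
  simp only [map_zero, sub_zero] at h
  refine closure_mono ?_ h
  rintro _ ⟨z, hz, rfl⟩
  have := spectrum.notMem_iff.1 hz
  simpa using this.neg

/-- The invertible case extends to all `R` because the condition is closed in `(R, V, W)` and the
unitary groups are compact. -/
lemma exists_isDiag_trace_le (R : Matrix (Fin 2 × Fin 2) (Fin 2 × Fin 2) ℂ) :
    ∃ V ∈ unitaryGroup (Fin 2 × Fin 2) ℂ, ∃ W ∈ unitaryGroup (Fin 2) ℂ,
      (Vᵀ * (Rᵀ * spinFlip * R) * V).IsDiag ∧
      ‖(Vᵀ * (Rᵀ * spinFlip * R) * V).trace‖ ^ 2 ≤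
        -4 * (partialExpectation (R * Rᴴ) (basisObservable W)).det.re := by
  have : CompactSpace (unitaryGroup (Fin 2 × Fin 2) ℂ) :=
    isCompact_iff_compactSpace.1 (isCompact_unitaryGroup _)
  have : CompactSpace (unitaryGroup (Fin 2) ℂ) :=
    isCompact_iff_compactSpace.1 (isCompact_unitaryGroup _)
  set F : Set (Matrix (Fin 2 × Fin 2) (Fin 2 × Fin 2) ℂ ×
      (unitaryGroup (Fin 2 × Fin 2) ℂ × unitaryGroup (Fin 2) ℂ)) :=
    {x | (∀ i j, i ≠ j → ((x.2.1 : Matrix (Fin 2 × Fin 2) (Fin 2 × Fin 2) ℂ)ᵀ *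
        (x.1ᵀ * spinFlip * x.1) * x.2.1) i j = 0) ∧
      ‖((x.2.1 : Matrix (Fin 2 × Fin 2) (Fin 2 × Fin 2) ℂ)ᵀ *
        (x.1ᵀ * spinFlip * x.1) * x.2.1).trace‖ ^ 2 ≤
        -4 * (partialExpectation (x.1 * x.1ᴴ) (basisObservable x.2.2)).det.re} with hF
  have hFc : IsClosed F := by
    have hV : Continuous fun x : Matrix (Fin 2 × Fin 2) (Fin 2 × Fin 2) ℂ ×
      (unitaryGroup (Fin 2 × Fin 2) ℂ × unitaryGroup (Fin 2) ℂ) =>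
        ((x.2.1 : Matrix (Fin 2 × Fin 2) (Fin 2 × Fin 2) ℂ)ᵀ *
        (x.1ᵀ * spinFlip * x.1) * x.2.1) := by fun_prop
    have hX : Continuous fun x : Matrix (Fin 2 × Fin 2) (Fin 2 × Fin 2) ℂ ×
      (unitaryGroup (Fin 2 × Fin 2) ℂ × unitaryGroup (Fin 2) ℂ) =>
        partialExpectation (x.1 * x.1ᴴ) (basisObservable x.2.2) := by
      unfold partialExpectation basisObservable
      refine continuous_matrix fun a a' => ?_
      simp only [of_apply]
      refine continuous_finsetSum _ fun b _ => continuous_finsetSum _ fun b' _ => ?_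
      refine Continuous.mul (Continuous.matrix_elem ?_ _ _) (Continuous.matrix_elem ?_ _ _)
      · fun_prop
      · fun_prop
    refine IsClosed.and ?_ ?_
    · simp only [Set.ofPred_forall]
      exact isClosed_iInter fun i => isClosed_iInter fun j => isClosed_iInter fun _ =>
        isClosed_eq (hV.matrix_elem i j) continuous_const
    · exact isClosed_le (hV.matrix_trace.norm.pow 2)
        (continuous_const.mul (Complex.continuous_re.comp hX.matrix_det))
  have hcl : IsClosed (Prod.fst '' F) := isClosedMap_fst_of_compactSpace F hFc
  have hsub : {M | IsUnit M} ⊆ Prod.fst '' F := by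
    intro M hM
    obtain ⟨V, hV, W, hW, h1, h2⟩ := exists_isDiag_trace_le_of_isUnit hM
    exact ⟨(M, ⟨V, hV⟩, ⟨W, hW⟩), ⟨fun i j hij => h1 hij, h2⟩, rfl⟩
  obtain ⟨⟨M, V, W⟩, ⟨h1, h2⟩, rfl⟩ := hcl.closure_subset_iff.2 hsub (mem_closure_isUnit R)
  exact ⟨V, V.2, W, W.2, fun i j hij => h1 i j hij, h2⟩

/-- The Hadamard matrix of two qubits. All its entries have modulus `1 / 2`. -/
noncomputable def twoQubitHadamard : Matrix (Fin 2 × Fin 2) (Fin 2 × Fin 2) ℂ :=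
  (1 / 2 : ℂ) • kroneckerMap (· * ·) !![1, 1; 1, -1] !![1, 1; 1, -1]

lemma twoQubitHadamard_mul_conjTranspose : twoQubitHadamard * twoQubitHadamardᴴ = 1 := by
  ext ⟨a, b⟩ ⟨a', b'⟩
  fin_cases a <;> fin_cases b <;> fin_cases a' <;> fin_cases b' <;>
    simp [twoQubitHadamard, mul_apply, Fintype.sum_prod_type, Fin.sum_univ_two, one_apply] <;> norm_num

lemma twoQubitHadamard_sq (i j : Fin 2 × Fin 2) : twoQubitHadamard i j ^ 2 = 1 / 4 := by
  obtain ⟨a, b⟩ := i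
  obtain ⟨a', b'⟩ := j
  fin_cases a <;> fin_cases b <;> fin_cases a' <;> fin_cases b' <;>
    simp [twoQubitHadamard] <;> norm_num

/-- A two-qubit ensemble whose members all have the same spin-flip form, so that no triangle
inequality is lost. -/
lemma exists_ensemble_two_qubits {ρ : Matrix (Fin 2 × Fin 2) (Fin 2 × Fin 2) ℂ}
    (hρ : ρ.PosSemidef) :
    ∃ W ∈ unitaryGroup (Fin 2) ℂ, ∃ χ : Fin 2 × Fin 2 → Fin 2 × Fin 2 → ℂ,
      ∑ i, ketBra (χ i) = ρ ∧
      (∑ i, 2 * ‖(coeffMatrix (χ i)).det‖) ^ 2 ≤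
        -4 * (partialExpectation ρ (basisObservable W)).det.re := by
  obtain ⟨R, rfl⟩ : ∃ R : Matrix (Fin 2 × Fin 2) (Fin 2 × Fin 2) ℂ, ρ = R * Rᴴ := by
    open scoped MatrixOrder in
    refine ⟨CFC.sqrt ρ, ?_⟩
    have h : (CFC.sqrt ρ)ᴴ = CFC.sqrt ρ :=
      (nonneg_iff_posSemidef.1 (CFC.sqrt_nonneg ρ)).isHermitian
    rw [h, CFC.sqrt_mul_sqrt_self ρ hρ.nonneg]
  obtain ⟨V, hV, W, hW, h1, h2⟩ := exists_isDiag_trace_le R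
  have hVV : V * Vᴴ = 1 := mem_unitaryGroup_iff.1 hV
  refine ⟨W, hW, (R * V * twoQubitHadamard).col, ?_, le_trans (le_of_eq ?_) h2⟩
  · rw [sum_ketBra_transpose, conjTranspose_mul, conjTranspose_mul]
    calc _ = R * (V * (twoQubitHadamard * twoQubitHadamardᴴ) * Vᴴ) * Rᴴ := by simp only [mul_assoc]
      _ = _ := by rw [twoQubitHadamard_mul_conjTranspose, mul_one, hVV, mul_one]
  · set T := Vᵀ * (Rᵀ * spinFlip * R) * V with hT
    have hi : ∀ i, 2 * ‖(coeffMatrix ((R * V * twoQubitHadamard).col i)).det‖ = ‖T.trace‖ / 4 := by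
      intro i
      have e : 2 * (coeffMatrix ((R * V * twoQubitHadamard).col i)).det = T.trace / 4 := by
        rw [← dotProduct_spinFlip_mulVec_self, ← transpose_mul_mul_apply]
        have : (R * V * twoQubitHadamard)ᵀ * spinFlip * (R * V * twoQubitHadamard)
            = twoQubitHadamardᵀ * T * twoQubitHadamard := by
          simp only [hT, transpose_mul, mul_assoc]
        rw [this, ← h1.diagonal_diag, mul_apply]
        simp only [mul_diagonal, transpose_apply, trace_diagonal]
        rw [Finset.sum_div]
        refine Finset.sum_congr rfl fun j _ => ?_
        linear_combination T.diag j * twoQubitHadamard_sq j i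
      have := congrArg norm e
      simpa using this
    simp only [hi, Finset.sum_const, Finset.card_univ, Fintype.card_prod, Fintype.card_fin]
    simp
    ring

/-! ### Concurrence of unnormalised vectors and monogamy -/

/-- The concurrence of a vector on a qubit and a second system, extended to vectors of arbitrary
norm as a function homogeneous of degree two. -/
noncomputable def vecConcurrence {B : Type*} [Fintype B] (φ : Fin 2 × B → ℂ) : ℝ :=
  Real.sqrt (4 * (reduceFst (ketBra φ)).det.re)

lemma reduceFst_ketBra {A B : Type*} [Fintype B] (φ : A × B → ℂ) :
    reduceFst (ketBra φ) = coeffMatrix φ * (coeffMatrix φ)ᴴ := by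
  ext i j
  simp [reduceFst, ketBra, vecMulVec_apply, coeffMatrix, mul_apply]

lemma det_reduceFst_ketBra_nonneg {B : Type*} [Fintype B] (φ : Fin 2 × B → ℂ) :
    0 ≤ (reduceFst (ketBra φ)).det.re := by
  rw [reduceFst_ketBra]
  exact (Complex.le_def.1 (posSemidef_self_mul_conjTranspose (coeffMatrix φ)).det_nonneg).1

lemma vecConcurrence_nonneg {B : Type*} [Fintype B] (φ : Fin 2 × B → ℂ) :
    0 ≤ vecConcurrence φ :=
  Real.sqrt_nonneg _

lemma vecConcurrence_sq {B : Type*} [Fintype B] (φ : Fin 2 × B → ℂ) :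
    vecConcurrence φ ^ 2 = 4 * (reduceFst (ketBra φ)).det.re :=
  Real.sq_sqrt (mul_nonneg (by norm_num) (det_reduceFst_ketBra_nonneg φ))

lemma trace_ketBra {ι : Type*} [Fintype ι] (φ : ι → ℂ) :
    (ketBra φ).trace = ((∑ i, ‖φ i‖ ^ 2 : ℝ) : ℂ) := by
  simp [ketBra, trace, vecMulVec_apply, Complex.mul_conj, Complex.normSq_eq_norm_sq]

lemma trace_reduceFst {A B : Type*} [Fintype A] [Fintype B] (ρ : Matrix (A × B) (A × B) ℂ) :
    (reduceFst ρ).trace = ρ.trace := by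
  simp [reduceFst, trace, Fintype.sum_prod_type]

lemma pureConcurrence_eq_vecConcurrence {B : Type*} [Fintype B] {φ : Fin 2 × B → ℂ}
    (hφ : IsUnitVector φ) : pureConcurrence φ = vecConcurrence φ := by
  have ht : (reduceFst (ketBra φ)).trace = 1 := by
    rw [trace_reduceFst, trace_ketBra, show ∑ i, ‖φ i‖ ^ 2 = 1 from hφ, Complex.ofReal_one]
  unfold pureConcurrence vecConcurrence
  congr 1
  set M := reduceFst (ketBra φ)
  have h : (M * M).trace = 1 - 2 * M.det := by
    rw [trace_fin_two] at ht
    simp only [trace_fin_two, mul_apply, Fin.sum_univ_two, det_fin_two]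
    linear_combination (M 0 0 + M 1 1 + 1) * ht
  rw [h]
  simp
  ring

lemma ketBra_smul {ι : Type*} (c : ℝ) (φ : ι → ℂ) :
    ketBra ((c : ℂ) • φ) = ((c ^ 2 : ℝ) : ℂ) • ketBra φ := by
  ext i j
  simp [ketBra, vecMulVec_apply]
  ring

lemma vecConcurrence_smul {B : Type*} [Fintype B] (c : ℝ) (φ : Fin 2 × B → ℂ) :
    vecConcurrence ((c : ℂ) • φ) = c ^ 2 * vecConcurrence φ := by
  have h : reduceFst (ketBra ((c : ℂ) • φ)) = ((c ^ 2 : ℝ) : ℂ) • reduceFst (ketBra φ) := by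
    rw [ketBra_smul]
    ext i j
    simp [reduceFst, Finset.mul_sum]
  have h' : 4 * (reduceFst (ketBra ((c : ℂ) • φ))).det.re
      = (c ^ 2) ^ 2 * (4 * (reduceFst (ketBra φ)).det.re) := by
    rw [h, det_smul, Fintype.card_fin, ← Complex.ofReal_pow, Complex.re_ofReal_mul]
    ring
  rw [vecConcurrence, h', Real.sqrt_mul (by positivity), Real.sqrt_sq (by positivity)]
  rfl

lemma vecConcurrence_two_qubits (φ : Fin 2 × Fin 2 → ℂ) :
    vecConcurrence φ = 2 * ‖(coeffMatrix φ).det‖ := by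
  have h : (reduceFst (ketBra φ)).det.re = ‖(coeffMatrix φ).det‖ ^ 2 := by
    have : (reduceFst (ketBra φ)).det = ((‖(coeffMatrix φ).det‖ ^ 2 : ℝ) : ℂ) := by
      rw [reduceFst_ketBra, det_mul, det_conjTranspose, ← Complex.normSq_eq_norm_sq]
      exact Complex.mul_conj _
    rw [this, Complex.ofReal_re]
  rw [vecConcurrence, h, show 4 * ‖(coeffMatrix φ).det‖ ^ 2 = (2 * ‖(coeffMatrix φ).det‖) ^ 2 by ring,
    Real.sqrt_sq (by positivity)]

lemma exists_isUnitVector_eq_smul {ι : Type*} [Fintype ι] [Nonempty ι] (ψ : ι → ℂ) :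
    ∃ φ : ι → ℂ, IsUnitVector φ ∧ ψ = ((Real.sqrt (∑ x, ‖ψ x‖ ^ 2) : ℝ) : ℂ) • φ := by
  classical
  set N := ∑ x, ‖ψ x‖ ^ 2 with hN
  have hN0 : 0 ≤ N := Finset.sum_nonneg fun _ _ => sq_nonneg _
  rcases hN0.eq_or_lt with h | h
  · refine ⟨Pi.single (Classical.arbitrary ι) 1, ?_, ?_⟩
    · simp [IsUnitVector, Pi.single_apply, apply_ite]
    · have h0 : ∀ x, ψ x = 0 := fun x => by
        have := (Finset.sum_eq_zero_iff_of_nonneg fun _ _ => sq_nonneg _).1 h.symm x (Finset.mem_univ x)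
        simpa using this
      ext x
      simp [h0, ← h]
  · have hs : Real.sqrt N ≠ 0 := (Real.sqrt_pos.2 h).ne'
    refine ⟨(((Real.sqrt N)⁻¹ : ℝ) : ℂ) • ψ, ?_, ?_⟩
    · simp only [IsUnitVector, Pi.smul_apply, smul_eq_mul, norm_mul, mul_pow, ← Finset.mul_sum,
        ← hN]
      rw [Complex.norm_real, Real.norm_eq_abs, sq_abs, inv_pow, Real.sq_sqrt hN0,
        inv_mul_cancel₀ h.ne']
    · rw [smul_smul, ← Complex.ofReal_mul, mul_inv_cancel₀ hs, Complex.ofReal_one, one_smul]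

/-- Any decomposition of a state into unnormalised rank-one operators can be normalised to a pure
state ensemble. -/
lemma sum_vecConcurrence_mem {B ι : Type*} [Fintype B] [Fintype ι]
    {ρ : Matrix (Fin 2 × B) (Fin 2 × B) ℂ} (hρ : ρ.trace = 1) (ψ : ι → Fin 2 × B → ℂ)
    (hψ : ∑ i, ketBra (ψ i) = ρ) : ∑ i, vecConcurrence (ψ i) ∈ ensembleConcurrences ρ := by
  have hne : Nonempty (Fin 2 × B) := by
    by_contra h
    rw [not_nonempty_iff] at h
    simp [trace] at hρ
  choose φ hφ hψφ using fun i => exists_isUnitVector_eq_smul (ψ i)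
  set N : ι → ℝ := fun i => ∑ x, ‖ψ i x‖ ^ 2 with hN
  have hN0 : ∀ i, 0 ≤ N i := fun i => Finset.sum_nonneg fun _ _ => sq_nonneg _
  have hket : ∀ i, ketBra (ψ i) = (N i : ℂ) • ketBra (φ i) := fun i => by
    rw [hψφ i, ketBra_smul, Real.sq_sqrt (hN0 i)]
  have hconc : ∀ i, vecConcurrence (ψ i) = N i * pureConcurrence (φ i) := fun i => by
    rw [hψφ i, vecConcurrence_smul, Real.sq_sqrt (hN0 i), pureConcurrence_eq_vecConcurrence (hφ i)]
  have e := (Fintype.equivFin ι).symm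
  refine ⟨Fintype.card ι, fun j => N (e j), fun j => φ (e j), ⟨fun j => hN0 _, ?_, fun j => hφ _, ?_⟩,
    ?_⟩
  · rw [e.sum_comp N]
    have h := congrArg trace hψ
    rw [trace_sum, hρ] at h
    simp only [trace_ketBra] at h
    exact_mod_cast h
  · rw [← hψ, e.sum_comp fun i => (N i : ℂ) • ketBra (φ i)]
    exact Finset.sum_congr rfl fun i _ => (hket i).symm
  · rw [e.sum_comp fun i => N i * pureConcurrence (φ i)]
    exact Finset.sum_congr rfl fun i _ => hconc i

lemma pureConcurrence_nonneg {A B : Type*} [Fintype A] [Fintype B] (φ : A × B → ℂ) :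
    0 ≤ pureConcurrence φ :=
  Real.sqrt_nonneg _

lemma nonneg_of_mem_ensembleConcurrences {A B : Type*} [Fintype A] [Fintype B]
    {ρ : Matrix (A × B) (A × B) ℂ} {c : ℝ} (hc : c ∈ ensembleConcurrences ρ) : 0 ≤ c := by
  obtain ⟨m, q, φ, h, rfl⟩ := hc
  exact Finset.sum_nonneg fun i _ => mul_nonneg (h.nonneg i) (pureConcurrence_nonneg _)

lemma concurrence_nonneg {A B : Type*} [Fintype A] [Fintype B] (ρ : Matrix (A × B) (A × B) ℂ) :
    0 ≤ concurrence ρ :=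
  Real.sInf_nonneg fun _ => nonneg_of_mem_ensembleConcurrences

lemma concurrence_le_sum_vecConcurrence {B ι : Type*} [Fintype B] [Fintype ι]
    {ρ : Matrix (Fin 2 × B) (Fin 2 × B) ℂ} (hρ : ρ.trace = 1) (ψ : ι → Fin 2 × B → ℂ)
    (hψ : ∑ i, ketBra (ψ i) = ρ) : concurrence ρ ≤ ∑ i, vecConcurrence (ψ i) :=
  csInf_le ⟨0, fun _ => nonneg_of_mem_ensembleConcurrences⟩ (sum_vecConcurrence_mem hρ ψ hψ)

lemma ensembleConcurrences_nonempty {B : Type*} [Fintype B]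
    {ρ : Matrix (Fin 2 × B) (Fin 2 × B) ℂ} (hρ : IsDensityMatrix ρ) :
    (ensembleConcurrences ρ).Nonempty := by
  obtain ⟨m, v, hv⟩ := posSemidef_iff_eq_sum_vecMulVec.1 hρ.1
  exact ⟨_, sum_vecConcurrence_mem hρ.2 v hv.symm⟩

lemma reduceOneTwo_ketBra {A B C : Type*} [Fintype C] (φ : A × B × C → ℂ) :
    reduceOneTwo (ketBra φ) = (of fun (x : A × B) l => φ (x.1, x.2, l)) *
      (of fun (x : A × B) l => φ (x.1, x.2, l))ᴴ := by
  ext x y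
  simp [reduceOneTwo, ketBra, vecMulVec_apply, mul_apply]

/-- The vector obtained by projecting the second factor onto the conjugate of the `b`-th column
of `W`. -/
def measureSecond {A B C : Type*} [Fintype B] (W : Matrix B B ℂ) (φ : A × B × C → ℂ) (b : B) :
    A × C → ℂ :=
  fun x => ∑ b', W b' b * φ (x.1, b', x.2)

lemma sum_ketBra_measureSecond {A B C : Type*} [Fintype B] [DecidableEq B] {W : Matrix B B ℂ}
    (hW : W ∈ unitaryGroup B ℂ) (φ : A × B × C → ℂ) :
    ∑ b, ketBra (measureSecond W φ b) = reduceOneThree (ketBra φ) := by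
  have hWW : W * Wᴴ = 1 := mem_unitaryGroup_iff.1 hW
  ext ⟨a, c⟩ ⟨a', c'⟩
  have h : ∀ b' b'', ∑ b, W b' b * star (W b'' b) = if b' = b'' then 1 else 0 := fun b' b'' => by
    have := congrFun (congrFun hWW b') b''
    simpa [mul_apply, one_apply] using this
  simp only [Matrix.sum_apply, ketBra, vecMulVec_apply, Pi.star_apply, measureSecond, star_sum,
    star_mul', Finset.sum_mul_sum, reduceOneThree, of_apply]
  rw [Finset.sum_comm]
  refine Finset.sum_congr rfl fun b' _ => ?_
  rw [Finset.sum_comm]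
  calc _ = ∑ b'', (∑ b, W b' b * star (W b'' b)) * (φ (a, b', c) * star (φ (a', b'', c'))) := by
        refine Finset.sum_congr rfl fun b'' _ => ?_
        rw [Finset.sum_mul]
        exact Finset.sum_congr rfl fun b _ => by ring
    _ = _ := by simp only [h]; simp

lemma reduceFst_reduceOneThree {A B C : Type*} [Fintype B] [Fintype C]
    (ρ : Matrix (A × B × C) (A × B × C) ℂ) : reduceFst (reduceOneThree ρ) = reduceFst ρ := by
  ext a a'
  simp only [reduceFst, reduceOneThree, of_apply, Fintype.sum_prod_type]
  exact Finset.sum_comm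

lemma sum_reduceFst_measureSecond {A B C : Type*} [Fintype B] [Fintype C] [DecidableEq B]
    {W : Matrix B B ℂ} (hW : W ∈ unitaryGroup B ℂ) (φ : A × B × C → ℂ) :
    ∑ b, reduceFst (ketBra (measureSecond W φ b)) = reduceFst (ketBra φ) := by
  rw [← reduceFst_reduceOneThree, ← sum_ketBra_measureSecond hW]
  ext a a'
  simp only [reduceFst, Matrix.sum_apply, of_apply]
  exact Finset.sum_comm

lemma reduceFst_measureSecond_sub {A C : Type*} [Fintype C] (W : Matrix (Fin 2) (Fin 2) ℂ)
    (φ : A × Fin 2 × C → ℂ) :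
    reduceFst (ketBra (measureSecond W φ 0)) - reduceFst (ketBra (measureSecond W φ 1)) =
      partialExpectation (reduceOneTwo (ketBra φ)) (basisObservable W) := by
  ext a a'
  simp only [reduceFst, partialExpectation, reduceOneTwo, Matrix.sub_apply, of_apply, ketBra,
    vecMulVec_apply, Pi.star_apply, measureSecond, Fin.sum_univ_two, Finset.mul_sum,
    ← Finset.sum_add_distrib, ← Finset.sum_sub_distrib]
  refine Finset.sum_congr rfl fun c _ => ?_
  simp [basisObservable, mul_apply, Fin.sum_univ_two]
  ring

/-- Monogamy for pure states, in the form of explicit decompositions of both reduced states. If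
`A₀` and `A₁` are the unnormalised states of the first qubit after a measurement of the second one,
then `det (A₀ + A₁) - 2 det A₀ - 2 det A₁ = -det (A₀ - A₁)`, and for a suitable measurement the right
side bounds the concurrence of the first two qubits. -/
lemma exists_decompositions_of_pure {C : Type*} [Fintype C] (φ : Fin 2 × Fin 2 × C → ℂ) :
    ∃ (ψ : Fin 2 × Fin 2 → Fin 2 × Fin 2 → ℂ) (χ : Fin 2 → Fin 2 × C → ℂ),
      ∑ i, ketBra (ψ i) = reduceOneTwo (ketBra φ) ∧
      ∑ i, ketBra (χ i) = reduceOneThree (ketBra φ) ∧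
      (∑ i, vecConcurrence (ψ i)) ^ 2 + (∑ i, vecConcurrence (χ i)) ^ 2 ≤ vecConcurrence φ ^ 2 := by
  have hpos : (reduceOneTwo (ketBra φ)).PosSemidef := by
    rw [reduceOneTwo_ketBra]
    exact posSemidef_self_mul_conjTranspose _
  obtain ⟨W, hW, ψ, hψ, hle⟩ := exists_ensemble_two_qubits hpos
  refine ⟨ψ, measureSecond W φ, hψ, sum_ketBra_measureSecond hW φ, ?_⟩
  have hsum := sum_reduceFst_measureSecond hW φ
  have hsub := reduceFst_measureSecond_sub W φ
  rw [← hsub] at hle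
  simp only [vecConcurrence_two_qubits] at hle ⊢
  rw [Fin.sum_univ_two] at hsum ⊢
  have h0 := vecConcurrence_sq (measureSecond W φ 0)
  have h1 := vecConcurrence_sq (measureSecond W φ 1)
  rw [vecConcurrence_sq φ, ← hsum]
  set A₀ := reduceFst (ketBra (measureSecond W φ 0))
  set A₁ := reduceFst (ketBra (measureSecond W φ 1))
  have hdet : (A₀ + A₁).det.re = 2 * A₀.det.re + 2 * A₁.det.re - (A₀ - A₁).det.re := by
    have : (A₀ + A₁).det = 2 * A₀.det + 2 * A₁.det - (A₀ - A₁).det := by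
      simp only [det_fin_two, Matrix.add_apply, Matrix.sub_apply]
      ring
    rw [this]
    simp
  rw [hdet]
  nlinarith [sq_nonneg (vecConcurrence (measureSecond W φ 0) - vecConcurrence (measureSecond W φ 1))]

lemma trace_reduceOneTwo {A B C : Type*} [Fintype A] [Fintype B] [Fintype C]
    (ρ : Matrix (A × B × C) (A × B × C) ℂ) : (reduceOneTwo ρ).trace = ρ.trace := by
  simp [reduceOneTwo, trace, Fintype.sum_prod_type]

lemma trace_reduceOneThree {A B C : Type*} [Fintype A] [Fintype B] [Fintype C]
    (ρ : Matrix (A × B × C) (A × B × C) ℂ) : (reduceOneThree ρ).trace = ρ.trace := by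
  rw [← trace_reduceFst, reduceFst_reduceOneThree, trace_reduceFst]

lemma concurrence_le_of_decomposition {B ι κ : Type*} [Fintype B] [Fintype ι] [Fintype κ]
    {ρ : Matrix (Fin 2 × B) (Fin 2 × B) ℂ} (hρ : ρ.trace = 1) {q : ι → ℝ} (hq : ∀ i, 0 ≤ q i)
    {σ : ι → Matrix (Fin 2 × B) (Fin 2 × B) ℂ} (hσ : ∑ i, (q i : ℂ) • σ i = ρ)
    (ψ : ι → κ → Fin 2 × B → ℂ) (hψ : ∀ i, ∑ j, ketBra (ψ i j) = σ i) :
    concurrence ρ ≤ ∑ i, q i * ∑ j, vecConcurrence (ψ i j) := by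
  refine (concurrence_le_sum_vecConcurrence hρ
    (fun x : ι × κ => ((Real.sqrt (q x.1) : ℝ) : ℂ) • ψ x.1 x.2) ?_).trans (le_of_eq ?_)
  · rw [← hσ, Fintype.sum_prod_type]
    refine Finset.sum_congr rfl fun i _ => ?_
    simp only [ketBra_smul, Real.sq_sqrt (hq i), ← Finset.smul_sum, hψ]
  · rw [Fintype.sum_prod_type]
    refine Finset.sum_congr rfl fun i _ => ?_
    simp only [vecConcurrence_smul, Real.sq_sqrt (hq i), ← Finset.mul_sum]

/-- **Monogamy of the squared concurrence** for two qubits and a third system of any dimension. The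
passage from pure to mixed states is the triangle inequality in the plane. -/
lemma concurrence_sq_add_sq_le {C : Type*} [Fintype C]
    {ρ : Matrix (Fin 2 × Fin 2 × C) (Fin 2 × Fin 2 × C) ℂ} (hρ : IsDensityMatrix ρ) :
    concurrence (reduceOneTwo ρ) ^ 2 + concurrence (reduceOneThree ρ) ^ 2 ≤ concurrence ρ ^ 2 := by
  rw [← Real.sqrt_le_left (concurrence_nonneg ρ)]
  refine le_csInf (ensembleConcurrences_nonempty hρ) ?_
  rintro _ ⟨m, q, φ, h, rfl⟩
  choose ψ χ hψ hχ hle using fun i => exists_decompositions_of_pure (φ i)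
  have h12 : concurrence (reduceOneTwo ρ) ≤ ∑ i, q i * ∑ j, vecConcurrence (ψ i j) := by
    refine concurrence_le_of_decomposition (by rw [trace_reduceOneTwo, hρ.2]) h.nonneg ?_ ψ hψ
    rw [← h.decomp]
    ext x y
    simp only [Matrix.sum_apply, Matrix.smul_apply, reduceOneTwo, of_apply, Finset.smul_sum]
    exact Finset.sum_comm
  have h13 : concurrence (reduceOneThree ρ) ≤ ∑ i, q i * ∑ j, vecConcurrence (χ i j) := by
    refine concurrence_le_of_decomposition (by rw [trace_reduceOneThree, hρ.2]) h.nonneg ?_ χ hχ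
    rw [← h.decomp]
    ext x y
    simp only [Matrix.sum_apply, Matrix.smul_apply, reduceOneThree, of_apply, Finset.smul_sum]
    exact Finset.sum_comm
  set a : Fin m → ℝ := fun i => ∑ j, vecConcurrence (ψ i j) with ha
  set b : Fin m → ℝ := fun i => ∑ j, vecConcurrence (χ i j) with hb
  calc Real.sqrt (concurrence (reduceOneTwo ρ) ^ 2 + concurrence (reduceOneThree ρ) ^ 2)
      ≤ Real.sqrt ((∑ i, q i * a i) ^ 2 + (∑ i, q i * b i) ^ 2) := by
        refine Real.sqrt_le_sqrt (add_le_add ?_ ?_)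
        · exact pow_le_pow_left₀ (concurrence_nonneg _) h12 2
        · exact pow_le_pow_left₀ (concurrence_nonneg _) h13 2
    _ = ‖∑ i, (q i : ℂ) * (a i + b i * Complex.I)‖ := by
        rw [← Complex.norm_add_mul_I]
        congr 1
        push_cast
        rw [Finset.sum_mul, ← Finset.sum_add_distrib]
        exact Finset.sum_congr rfl fun i _ => by ring
    _ ≤ ∑ i, ‖(q i : ℂ) * (a i + b i * Complex.I)‖ := norm_sum_le _ _
    _ ≤ ∑ i, q i * pureConcurrence (φ i) := by
        refine Finset.sum_le_sum fun i _ => ?_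
        rw [norm_mul, Complex.norm_real, Real.norm_of_nonneg (h.nonneg i),
          Complex.norm_add_mul_I, pureConcurrence_eq_vecConcurrence (h.unit i)]
        refine mul_le_mul_of_nonneg_left ?_ (h.nonneg i)
        rw [Real.sqrt_le_left (vecConcurrence_nonneg _)]
        exact hle i

/-! ### Weighted monogamy -/

theorem theorem1 (n : ℕ) (hn : 2 ≤ n)
    (ρ : Matrix (Fin 2 × Fin 2 × Fin (2 ^ (n - 2))) (Fin 2 × Fin 2 × Fin (2 ^ (n - 2))) ℂ)
    (hρ : IsDensityMatrix ρ)
    (k p r α : ℝ) (hk : 1 ≤ k) (hp : 1 / 2 ≤ p) (hp' : p ≤ 1) (hr : 2 ≤ r)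
    (hα : 0 ≤ α) (hα' : α ≤ r / 2) :
    (concurrence (reduceOneThree ρ) ^ r ≥ k * concurrence (reduceOneTwo ρ) ^ r →
      concurrence ρ ^ α ≥
        p ^ (α / r) * concurrence (reduceOneTwo ρ) ^ α +
          ((1 + k) ^ (α / r) - p ^ (α / r)) / k ^ (α / r) *
            concurrence (reduceOneThree ρ) ^ α) ∧
    (concurrence (reduceOneTwo ρ) ^ r ≥ k * concurrence (reduceOneThree ρ) ^ r →
      concurrence ρ ^ α ≥
        p ^ (α / r) * concurrence (reduceOneThree ρ) ^ α +
          ((1 + k) ^ (α / r) - p ^ (α / r)) / k ^ (α / r) *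
            concurrence (reduceOneTwo ρ) ^ α) := by
  have hmono := concurrence_sq_add_sq_le hρ
  refine ⟨fun h => ?_, fun h => ?_⟩
  · exact rpow_weighted_le_of_sq_add_sq_le (concurrence_nonneg _) (concurrence_nonneg _)
      (concurrence_nonneg _) hmono hk hp hr hα hα' h
  · rw [add_comm] at hmono
    exact rpow_weighted_le_of_sq_add_sq_le (concurrence_nonneg _) (concurrence_nonneg _)
      (concurrence_nonneg _) hmono hk hp hr hα hα' h
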